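/- Let $m\ge 2$ and let $\{X(t):t\ge 0\}$ be an irreducible continuous-time Markov chain (the environment) on $\{1,\dots,m\}$ with generator $Q$ and arbitrary initial distribution. Let $\hat X_0,\hat X_1,\dots$ be its jump chain and $\xi_0,\xi_1,\dots$ its successive sojourn times, and put $c_\ell=|Q_{\ell\ell}|$, $C=\mathrm{diag}(c_1,\dots,c_m)$, $\hat P=I+C^{-1}Q$ (the transition matrix of the jump chain), and let $\hat\pi$ be the stationary probability vector of $\hat P$. For each $\ell$ let $\Omega_\ell$ be an irreducible real $r\times r$ matrix with nonnegative off-diagonal entries (for $r=1$: any real number), such that $e^{\Omega_\ell t}$ is the mean population size matrix of an $r$-type Markovian branching process while $X(\cdot)=\ell$. The growth rate $\omega$ is the constant such that, almost surely and for all $i,j$, $$\omega=\lim_{n\to\infty}\frac1n\log\{e^{\Omega_{\hat X_0}\xi_0}e^{\Omega_{\hat X_1}\xi_1}\cdots e^{\Omega_{\hat X_{n-1}}\xi_{n-1}}\}_{ij}.$$ Let $\lambda_\ell$ be the eigenvalue of $\Omega_\ell$ of maximal real part, $u_\ell$ (row) and $v_\ell$ (column) the corresponding positive left and right eigenvectors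 with $u_\ell\mathbf 1=1$ and $u_\ell v_\ell=1$, $\lambda=(\lambda_1,\dots,\lambda_m)^\top$, $\Omega^*_\ell=\Omega_\ell-\lambda_\ell I$, $\Delta_\ell=\mathrm{diag}(v_\ell)$, $\Theta_\ell=\Delta_\ell^{-1}\Omega_\ell^*\Delta_\ell$, $M_\ell=c_\ell\Delta_\ell(c_\ell I-\Theta_\ell)^{-1}\Delta_\ell^{-1}$, $N_\ell=c_\ell(c_\ell I-\Theta_\ell)^{-1}$, and let $M$, $N$ be the block-diagonal matrices with diagonal blocks $M_\ell$, $N_\ell$. Define $$\omega_U=\hat\pi C^{-1}\lambda+\log\mathrm{sp}[M(\hat P\otimes I_r)],\qquad \omega_L=\hat\pi C^{-1}\lambda+\pi^{(1)}(I-N)\log\bar v,$$ where $\mathrm{sp}$ is the spectral radius, $\pi^{(1)}$ is the stationary probability vector of $N(\hat P\otimes I_r)$, $\bar v$ is the column vector formed by stacking $v_1,\dots,v_m$, and the logarithm of a vector is taken entrywise. Put $\Delta'_\ell=\mathrm{diag}(u_\ell)$, $\Theta'_\ell=(\Delta'_\ell)^{-1}(\Omega_\ell^*)^\top\Delta'_\ell$,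 $\widetilde N_\ell=c_\ell(c_\ell I-\Theta'_\ell)^{-1}$, let $\widetilde N$ be the block-diagonal matrix with blocks $\widetilde N_\ell$, let $\widetilde P=\mathrm{diag}(\hat\pi)^{-1}\hat P^\top\mathrm{diag}(\hat\pi)$, let $\widetilde\pi^{(1)}$ be the stationary probability vector of $\widetilde N(\widetilde P\otimes I_r)$, let $\bar u=(u_1,\dots,u_m)$, and define $$\widetilde\omega_L=\hat\pi C^{-1}\lambda+\widetilde\pi^{(1)}(I-\widetilde N)\log\bar u^\top.$$ When the environment is cyclic, i.e. its jump chain follows the deterministic cycle $1\to2\to\cdots\to m\to1$, define also $$\omega_L^*=\hat\pi C^{-1}\lambda+\frac1m\sum_{1\le i,j\le r}\beta_{ij}\,\mathbb E\big[\log\mathbb E[R_0\mid\varphi_0=i,\varphi_m=j,\zeta^*]\big],\qquad R_0=\frac{v_{1,\varphi_0}v_{2,\varphi_1}\cdots v_{m,\varphi_{m-1}}}{v_{m,\varphi_0}v_{1,\varphi_1}\cdots v_{m-1,\varphi_{m-1}}},$$ where $v_{\ell,a}=(v_\ell)_a$, $\zeta^*=(\xi_1^*,\dots,\xi_m^*)$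 has independent exponential entries with parameters $c_1,\dots,c_m$; given $\zeta^*$, the sequence $\varphi_0,\dots,\varphi_m$ is a Markov chain on $\{1,\dots,r\}$ whose $k$-th step has transition matrix $e^{\Theta_k\xi_k^*}$; $\beta_{ij}=\alpha_i(N_1\cdots N_m)_{ij}$; and $\alpha$ is the stationary probability vector of $N_1\cdots N_m$. **Lemma.** If $r=1$, then the limit $\omega$ exists and $$\omega_L=\widetilde\omega_L=\omega_U=\omega=\hat\pi C^{-1}\lambda,$$ and, if the environment is cyclic, also $\omega_L^*=\omega$. -/

import Mathlib

open MeasureTheory ProbabilityTheory Filter Topology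
open scoped NNReal ENNReal Matrix Kronecker

noncomputable section

namespace BranchingEnv

/-! ### Matrices and vectors -/

/-- `Q` is the generator of an irreducible continuous-time Markov chain. -/
structure IsIrreducibleGenerator {m : ℕ} (Q : Matrix (Fin m) (Fin m) ℝ) : Prop where
  offDiag_nonneg : ∀ i j, i ≠ j → 0 ≤ Q i j
  row_sum : ∀ i, ∑ j, Q i j = 0
  irreducible : ∀ i j, Relation.ReflTransGen (fun a b => 0 < Q a b) i j

/-- `p` is a stationary probability (row) vector of `P`. -/
def IsStationary {ι : Type*} [Fintype ι] (P : Matrix ι ι ℝ) (p : ι → ℝ) : Prop :=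
  (∀ i, 0 ≤ p i) ∧ ∑ i, p i = 1 ∧ p ᵥ* P = p

/-- The stationary probability vector of `P`. -/
def stationary {ι : Type*} [Fintype ι] (P : Matrix ι ι ℝ) : ι → ℝ :=
  Classical.epsilon (IsStationary P)

/-- The spectral radius `sp A` of a real matrix, over its complex eigenvalues. -/
def sp {ι : Type*} [Fintype ι] [DecidableEq ι] (A : Matrix ι ι ℝ) : ℝ :=
  (spectralRadius ℂ (A.map (Complex.ofReal : ℝ → ℂ))).toReal

/-- The maximal real part of the complex eigenvalues of a real matrix. -/
def maxRealPart {ι : Type*} [Fintype ι] [DecidableEq ι] (A : Matrix ι ι ℝ) : ℝ :=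
  sSup (Complex.re '' spectrum ℂ (A.map (Complex.ofReal : ℝ → ℂ)))

/-- The positive left eigenvector `u` of `A` for the eigenvalue of maximal real part,
normalised by `u 1 = 1`. -/
def leftVec {ι : Type*} [Fintype ι] [DecidableEq ι] (A : Matrix ι ι ℝ) : ι → ℝ :=
  Classical.epsilon fun u => (∀ i, 0 < u i) ∧ u ᵥ* A = maxRealPart A • u ∧ ∑ i, u i = 1

/-- The positive right eigenvector `v` of `A` for the eigenvalue of maximal real part,
normalised by `u v = 1`, where `u` is the left one. -/
def rightVec {ι : Type*} [Fintype ι] [DecidableEq ι] (A : Matrix ι ι ℝ) : ι → ℝ :=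
  Classical.epsilon fun v =>
    (∀ i, 0 < v i) ∧ A *ᵥ v = maxRealPart A • v ∧ leftVec A ⬝ᵥ v = 1

/-- The block-diagonal matrix with diagonal blocks `A 1, …, A m`. -/
def blockDiag {m r : ℕ} (A : Fin m → Matrix (Fin r) (Fin r) ℝ) :
    Matrix (Fin m × Fin r) (Fin m × Fin r) ℝ :=
  Matrix.of fun p q => if p.1 = q.1 then A p.1 p.2 q.2 else 0

/-! ### The environment -/

variable {m r : ℕ}

/-- The parameters `c_ℓ = |Q_ℓℓ|` of the sojourn times. -/
def rate (Q : Matrix (Fin m) (Fin m) ℝ) (l : Fin m) : ℝ := |Q l l|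

/-- `C = diag(c_1, …, c_m)`. -/
def rateMatrix (Q : Matrix (Fin m) (Fin m) ℝ) : Matrix (Fin m) (Fin m) ℝ :=
  Matrix.diagonal (rate Q)

/-- The transition matrix `P̂ = I + C⁻¹ Q` of the jump chain. -/
def jumpMatrix (Q : Matrix (Fin m) (Fin m) ℝ) : Matrix (Fin m) (Fin m) ℝ :=
  1 + (rateMatrix Q)⁻¹ * Q

/-- The stationary probability vector `π̂` of the jump chain. -/
def piHat (Q : Matrix (Fin m) (Fin m) ℝ) : Fin m → ℝ := stationary (jumpMatrix Q)

/-- The jump epochs `τ_0 = 0 < τ_1 < τ_2 < …` of a path. (If there is no further jump, the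
infimum is that of the empty set; for a Markov chain as below this has probability zero.) -/
def jumpTime {E : Type*} (x : ℝ≥0 → E) : ℕ → ℝ≥0
  | 0 => 0
  | k + 1 => sInf {t | jumpTime x k < t ∧ x t ≠ x (jumpTime x k)}

/-- The successive states visited by a path. -/
def jumpState {E : Type*} (x : ℝ≥0 → E) (k : ℕ) : E := x (jumpTime x k)

/-- The successive sojourn times `ξ_k = τ_{k+1} - τ_k` of a path. -/
def sojourn {E : Type*} (x : ℝ≥0 → E) (k : ℕ) : ℝ :=
  (jumpTime x (k + 1) : ℝ) - jumpTime x k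

/-- `X` is a continuous-time Markov chain with generator `Q` (and any initial distribution):
a right-continuous process whose jump chain is a Markov chain with transition matrix `P̂`,
and whose sojourn times are, conditionally on the jump chain, independent and exponentially
distributed with parameters `c_ℓ`, where `ℓ` are the states visited. -/
structure IsMarkovEnvironment {S : Type*} [MeasurableSpace S] (μ : Measure S)
    (Q : Matrix (Fin m) (Fin m) ℝ) (X : ℝ≥0 → S → Fin m) : Prop where
  measurable : ∀ t, Measurable (X t)
  rightCts : ∀ a t, ContinuousWithinAt (fun s => X s a) (Set.Ici t) t
  measurable_jumpState : ∀ k, Measurable fun a => jumpState (fun t => X t a) k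
  measurable_sojourn : ∀ k, Measurable fun a => sojourn (fun t => X t a) k
  law : ∀ (n : ℕ) (x : ℕ → Fin m) (B : ℕ → Set ℝ), (∀ k, MeasurableSet (B k)) →
    μ {a | ∀ k ≤ n, jumpState (fun t => X t a) k = x k ∧ sojourn (fun t => X t a) k ∈ B k} =
      μ {a | jumpState (fun t => X t a) 0 = x 0} *
        (∏ k ∈ Finset.range n, ENNReal.ofReal (jumpMatrix Q (x k) (x (k + 1)))) *
        ∏ k ∈ Finset.range (n + 1), expMeasure (rate Q (x k)) (B k)

/-! ### The growth rate `ω` -/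

/-- The product `e^{Ω̂_0 ξ_0} e^{Ω̂_1 ξ_1} ⋯ e^{Ω̂_{n-1} ξ_{n-1}}` along a path of the
environment. -/
def meanProduct (Om : Fin m → Matrix (Fin r) (Fin r) ℝ) (x : ℝ≥0 → Fin m) :
    ℕ → Matrix (Fin r) (Fin r) ℝ
  | 0 => 1
  | n + 1 => meanProduct Om x n * NormedSpace.exp (sojourn x n • Om (jumpState x n))

/-- `w` is the almost sure limit, for all `i` and `j`, of
`(1/n) log {e^{Ω̂_0 ξ_0} ⋯ e^{Ω̂_{n-1} ξ_{n-1}}}_{ij}`. -/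
def IsGrowthRate {S : Type*} [MeasurableSpace S] (μ : Measure S)
    (Om : Fin m → Matrix (Fin r) (Fin r) ℝ) (X : ℝ≥0 → S → Fin m) (w : ℝ) : Prop :=
  ∀ i j, ∀ᵐ a ∂μ, Tendsto
    (fun n : ℕ => 1 / (n : ℝ) * Real.log (meanProduct Om (fun t => X t a) n i j)) atTop (𝓝 w)

/-! ### The first dual process: upper and lower bounds -/

/-- The vector `(λ_1, …, λ_m)` of growth rates. -/
def lam (Om : Fin m → Matrix (Fin r) (Fin r) ℝ) (l : Fin m) : ℝ := maxRealPart (Om l)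

/-- `π̂ C⁻¹ λ`. -/
def meanRate (Q : Matrix (Fin m) (Fin m) ℝ) (Om : Fin m → Matrix (Fin r) (Fin r) ℝ) : ℝ :=
  piHat Q ⬝ᵥ ((rateMatrix Q)⁻¹ *ᵥ lam Om)

/-- `Ω*_ℓ = Ω_ℓ - λ_ℓ I`. -/
def OmStar (Om : Fin m → Matrix (Fin r) (Fin r) ℝ) (l : Fin m) : Matrix (Fin r) (Fin r) ℝ :=
  Om l - lam Om l • 1

/-- `Δ_ℓ = diag(v_ℓ)`. -/
def Del (Om : Fin m → Matrix (Fin r) (Fin r) ℝ) (l : Fin m) : Matrix (Fin r) (Fin r) ℝ :=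
  Matrix.diagonal (rightVec (Om l))

/-- `Θ_ℓ = Δ_ℓ⁻¹ Ω*_ℓ Δ_ℓ`. -/
def Theta (Om : Fin m → Matrix (Fin r) (Fin r) ℝ) (l : Fin m) : Matrix (Fin r) (Fin r) ℝ :=
  (Del Om l)⁻¹ * OmStar Om l * Del Om l

/-- `M_ℓ = c_ℓ Δ_ℓ (c_ℓ I - Θ_ℓ)⁻¹ Δ_ℓ⁻¹`. -/
def MBlock (Q : Matrix (Fin m) (Fin m) ℝ) (Om : Fin m → Matrix (Fin r) (Fin r) ℝ) (l : Fin m) :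
    Matrix (Fin r) (Fin r) ℝ :=
  rate Q l • (Del Om l * (rate Q l • 1 - Theta Om l)⁻¹ * (Del Om l)⁻¹)

/-- `N_ℓ = c_ℓ (c_ℓ I - Θ_ℓ)⁻¹`. -/
def NBlock (Q : Matrix (Fin m) (Fin m) ℝ) (Om : Fin m → Matrix (Fin r) (Fin r) ℝ) (l : Fin m) :
    Matrix (Fin r) (Fin r) ℝ :=
  rate Q l • (rate Q l • 1 - Theta Om l)⁻¹

/-- The upper bound `ω_U = π̂ C⁻¹ λ + log sp[M (P̂ ⊗ I_r)]`. -/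
def omegaU (Q : Matrix (Fin m) (Fin m) ℝ) (Om : Fin m → Matrix (Fin r) (Fin r) ℝ) : ℝ :=
  meanRate Q Om +
    Real.log (sp (blockDiag (MBlock Q Om) * (jumpMatrix Q ⊗ₖ (1 : Matrix (Fin r) (Fin r) ℝ))))

/-- `P⁽¹⁾ = N (P̂ ⊗ I_r)`. -/
def POne (Q : Matrix (Fin m) (Fin m) ℝ) (Om : Fin m → Matrix (Fin r) (Fin r) ℝ) :
    Matrix (Fin m × Fin r) (Fin m × Fin r) ℝ :=
  blockDiag (NBlock Q Om) * (jumpMatrix Q ⊗ₖ (1 : Matrix (Fin r) (Fin r) ℝ))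

/-- The lower bound `ω_L = π̂ C⁻¹ λ + π⁽¹⁾ (I - N) log v̄`. -/
def omegaL (Q : Matrix (Fin m) (Fin m) ℝ) (Om : Fin m → Matrix (Fin r) (Fin r) ℝ) : ℝ :=
  meanRate Q Om +
    (stationary (POne Q Om) ᵥ* (1 - blockDiag (NBlock Q Om))) ⬝ᵥ
      fun p => Real.log (rightVec (Om p.1) p.2)

/-! ### The second dual process: alternative lower bound -/

/-- `Δ'_ℓ = diag(u_ℓ)`. -/
def Del' (Om : Fin m → Matrix (Fin r) (Fin r) ℝ) (l : Fin m) : Matrix (Fin r) (Fin r) ℝ :=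
  Matrix.diagonal (leftVec (Om l))

/-- `Θ'_ℓ = (Δ'_ℓ)⁻¹ (Ω*_ℓ)ᵀ Δ'_ℓ`. -/
def Theta' (Om : Fin m → Matrix (Fin r) (Fin r) ℝ) (l : Fin m) : Matrix (Fin r) (Fin r) ℝ :=
  (Del' Om l)⁻¹ * (OmStar Om l)ᵀ * Del' Om l

/-- The transition matrix `P̃ = diag(π̂)⁻¹ P̂ᵀ diag(π̂)` of the time-reversed jump chain. -/
def revMatrix (Q : Matrix (Fin m) (Fin m) ℝ) : Matrix (Fin m) (Fin m) ℝ :=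
  (Matrix.diagonal (piHat Q))⁻¹ * (jumpMatrix Q)ᵀ * Matrix.diagonal (piHat Q)

/-- `Ñ_ℓ = c_ℓ (c_ℓ I - Θ'_ℓ)⁻¹`. -/
def NTildeBlock (Q : Matrix (Fin m) (Fin m) ℝ) (Om : Fin m → Matrix (Fin r) (Fin r) ℝ)
    (l : Fin m) : Matrix (Fin r) (Fin r) ℝ :=
  rate Q l • (rate Q l • 1 - Theta' Om l)⁻¹

/-- `P̃⁽¹⁾ = Ñ (P̃ ⊗ I_r)`. -/
def PTildeOne (Q : Matrix (Fin m) (Fin m) ℝ) (Om : Fin m → Matrix (Fin r) (Fin r) ℝ) :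
    Matrix (Fin m × Fin r) (Fin m × Fin r) ℝ :=
  blockDiag (NTildeBlock Q Om) * (revMatrix Q ⊗ₖ (1 : Matrix (Fin r) (Fin r) ℝ))

/-- The lower bound `ω̃_L = π̂ C⁻¹ λ + π̃⁽¹⁾ (I - Ñ) log ūᵀ`. -/
def omegaLTilde (Q : Matrix (Fin m) (Fin m) ℝ) (Om : Fin m → Matrix (Fin r) (Fin r) ℝ) : ℝ :=
  meanRate Q Om +
    (stationary (PTildeOne Q Om) ᵥ* (1 - blockDiag (NTildeBlock Q Om))) ⬝ᵥ
      fun p => Real.log (leftVec (Om p.1) p.2)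

/-! ### Cyclic environments: improved lower bound -/

/-- The jump chain follows the deterministic cycle `1 → 2 → ⋯ → m → 1`. -/
def IsCyclic (Q : Matrix (Fin m) (Fin m) ℝ) : Prop :=
  ∀ l, jumpMatrix Q l (finRotate m l) = 1

/-- `R_0 = (v_{1,φ_0} v_{2,φ_1} ⋯ v_{m,φ_{m-1}}) / (v_{m,φ_0} v_{1,φ_1} ⋯ v_{m-1,φ_{m-1}})`
as a function of the states `φ_0, …, φ_m` of the dual chain during one cycle. -/
def RZero (Om : Fin m → Matrix (Fin r) (Fin r) ℝ) (phi : Fin (m + 1) → Fin r) : ℝ :=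
  (∏ k : Fin m, rightVec (Om k) (phi k.castSucc)) /
    ∏ k : Fin m, rightVec (Om ((finRotate m).symm k)) (phi k.castSucc)

/-- The conditional probability of the path `φ_1, …, φ_m` of the dual chain during one cycle,
given `φ_0` and the sojourn times `z_1, …, z_m`: the dual process evolves according to the
generator `Θ_k` during the `k`-th sojourn. -/
def pathProb (Om : Fin m → Matrix (Fin r) (Fin r) ℝ) (z : Fin m → ℝ)
    (phi : Fin (m + 1) → Fin r) : ℝ :=
  ∏ k : Fin m, NormedSpace.exp (z k • Theta Om k) (phi k.castSucc) (phi k.succ)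

/-- `𝔼[R_0 | φ_0 = i, φ_m = j, ζ* = z]`. -/
def condR (Om : Fin m → Matrix (Fin r) (Fin r) ℝ) (i j : Fin r) (z : Fin m → ℝ) : ℝ :=
  (∑ phi : Fin (m + 1) → Fin r with phi 0 = i ∧ phi (Fin.last m) = j,
      RZero Om phi * pathProb Om z phi) /
    ∑ phi : Fin (m + 1) → Fin r with phi 0 = i ∧ phi (Fin.last m) = j, pathProb Om z phi

/-- The product `N_1 N_2 ⋯ N_m`. -/
def NProd (Q : Matrix (Fin m) (Fin m) ℝ) (Om : Fin m → Matrix (Fin r) (Fin r) ℝ) :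
    Matrix (Fin r) (Fin r) ℝ :=
  (List.ofFn (NBlock Q Om)).prod

/-- `β_{ij} = α_i (N_1 ⋯ N_m)_{ij}`, with `α` the stationary vector of `N_1 ⋯ N_m`. -/
def beta (Q : Matrix (Fin m) (Fin m) ℝ) (Om : Fin m → Matrix (Fin r) (Fin r) ℝ)
    (i j : Fin r) : ℝ :=
  stationary (NProd Q Om) i * NProd Q Om i j

/-- The lower bound
`ω_L* = π̂ C⁻¹ λ + (1/m) ∑_{i,j} β_{ij} 𝔼[log 𝔼[R_0 | φ_0 = i, φ_m = j, ζ*]]`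
for a cyclic environment; the entries of `ζ*` are independent and exponentially distributed
with parameters `c_1, …, c_m`. -/
def omegaLStar (Q : Matrix (Fin m) (Fin m) ℝ) (Om : Fin m → Matrix (Fin r) (Fin r) ℝ) : ℝ :=
  meanRate Q Om + 1 / (m : ℝ) * ∑ i, ∑ j, beta Q Om i j *
    ∫ z, Real.log (condR Om i j z) ∂(Measure.pi fun l => expMeasure (rate Q l))

end BranchingEnv

end

/-! With one type every `Om l` is a number, equal to its own eigenvalue `lam Om l`, and the
normalisations force both eigenvectors to be 1. Hence `OmStar`, `Theta` and `Theta'` vanish and the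
blocks of `M`, `N` and `Ñ` are identities. The corrections in `omegaL` and `omegaLTilde` contain the
factor `1 - 1`, the one in `omegaLStar` is an integral of `log 1`, and the one in `omegaU` is the
logarithm of the spectral radius of a stochastic matrix, which is 1 (`sp_eq_one`). All bounds
collapse to `meanRate`.

The substance is that the growth rate is `meanRate` too. The logarithm of the scalar product is the
sum of `ξ k * λ (Y k)`, so a strong law is needed for a Markov chain with exponential holding times,
from any initial law and without aperiodicity (`IsMarkovHolding.ae_tendsto_average`). With `g` a
solution of the Poisson equation `g - P g = w / c - b`, where `b = π ⬝ᵥ (w / c)`, one has `ξ k * w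
(Y k) - b = w (Y k) * (ξ k - 1 / c (Y k)) + (g (Y (k+1)) - (P g) (Y k)) + (g (Y k) - g (Y (k+1)))`.
The first two terms are orthogonal sequences with bounded second moments, whose averages vanish
almost surely (`ae_tendsto_average_of_orthogonal`); the last one telescopes. -/

namespace BranchingEnv

/-! ### Stochastic matrices -/

/-- A finite stochastic matrix has a stationary probability vector. -/
lemma exists_isStationary {ι : Type*} [Fintype ι] [DecidableEq ι] [Nonempty ι]
    {P : Matrix ι ι ℝ} (h0 : ∀ i j, 0 ≤ P i j) (h1 : ∀ i, ∑ j, P i j = 1) :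
    ∃ p, IsStationary P p := by
  have hv : (1 - P) *ᵥ (fun _ => (1 : ℝ)) = 0 := by
    ext i
    simp [Matrix.mulVec, dotProduct, h1, Matrix.one_apply]
  have hdet : (1 - P).det = 0 := by
    refine Matrix.exists_mulVec_eq_zero_iff.1 ⟨_, ?_, hv⟩
    intro h
    exact one_ne_zero (congrFun h (Classical.arbitrary ι))
  obtain ⟨q, hq0, hq⟩ := Matrix.exists_vecMul_eq_zero_iff.2 hdet
  have hqP : ∀ j, ∑ i, q i * P i j = q j := by
    intro j
    have := congrFun hq j
    rw [Matrix.vecMul_sub, Matrix.vecMul_one] at this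
    simp only [Pi.sub_apply, Matrix.vecMul, dotProduct, Pi.zero_apply] at this
    linarith
  -- The left null vector `q` may change sign. Both sides of this triangle inequality have the same
  -- total because the rows of `P` sum to one, so equality holds entrywise and `|q|` is itself
  -- invariant.
  have hle : ∀ j, |q j| ≤ ∑ i, |q i| * P i j := by
    intro j
    calc |q j| = |∑ i, q i * P i j| := by rw [hqP]
      _ ≤ ∑ i, |q i * P i j| := Finset.abs_sum_le_sum_abs _ _
      _ = ∑ i, |q i| * P i j := by simp [abs_mul, abs_of_nonneg (h0 _ _)]
  have hsum : ∑ j, |q j| = ∑ j, ∑ i, |q i| * P i j := by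
    rw [Finset.sum_comm]
    simp [← Finset.mul_sum, h1]
  have heq := (Finset.sum_eq_sum_iff_of_le fun j _ => hle j).1 hsum
  have hpos : 0 < ∑ j, |q j| := by
    obtain ⟨i, hi⟩ := Function.ne_iff.1 hq0
    exact Finset.sum_pos' (fun _ _ => abs_nonneg _) ⟨i, Finset.mem_univ _, abs_pos.2 hi⟩
  refine ⟨fun i => |q i| / ∑ j, |q j|, fun i => by positivity, ?_, ?_⟩
  · rw [← Finset.sum_div, div_self hpos.ne']
  · ext j
    simp only [Matrix.vecMul, dotProduct]
    rw [heq j (Finset.mem_univ _), Finset.sum_div]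
    exact Finset.sum_congr rfl fun i _ => by ring

lemma isStationary_stationary {ι : Type*} [Fintype ι] [DecidableEq ι] [Nonempty ι]
    {P : Matrix ι ι ℝ} (h0 : ∀ i j, 0 ≤ P i j) (h1 : ∀ i, ∑ j, P i j = 1) :
    IsStationary P (stationary P) :=
  Classical.epsilon_spec (exists_isStationary h0 h1)

/-- Harmonic functions of an irreducible stochastic matrix are constant. -/
lemma harmonic_const {ι : Type*} [Fintype ι] [Nonempty ι]
    {P : Matrix ι ι ℝ} (h0 : ∀ i j, 0 ≤ P i j) (h1 : ∀ i, ∑ j, P i j = 1)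
    (hirr : ∀ i j, Relation.ReflTransGen (fun a b => 0 < P a b) i j)
    {g : ι → ℝ} (hg : P *ᵥ g = g) : ∃ a, ∀ i, g i = a := by
  -- Maximum principle: at a state where `g` is maximal, the nonnegative deficits `g i - g k`
  -- average to zero, so every successor is maximal too; irreducibility carries this to all states.
  obtain ⟨i, hi⟩ := Finite.exists_max g
  refine ⟨g i, fun j => ?_⟩
  induction hirr i j with
  | refl => rfl
  | @tail b d _ hbd ih =>
    have hz : ∑ k, P b k * (g i - g k) = 0 := by
      have := congrFun hg b
      simp only [Matrix.mulVec, dotProduct] at this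
      simp only [mul_sub, Finset.sum_sub_distrib, this, ← Finset.sum_mul, h1, ih]
      ring
    have hd := (Finset.sum_eq_zero_iff_of_nonneg
      (fun k _ => mul_nonneg (h0 b k) (sub_nonneg.2 (hi k)))).1 hz d (Finset.mem_univ _)
    rcases mul_eq_zero.1 hd with h | h
    · exact absurd h hbd.ne'
    · linarith

/-- The Poisson equation of an irreducible stochastic matrix is solvable. -/
lemma exists_poisson {ι : Type*} [Fintype ι] [DecidableEq ι] [Nonempty ι]
    {P : Matrix ι ι ℝ} (h0 : ∀ i j, 0 ≤ P i j) (h1 : ∀ i, ∑ j, P i j = 1)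
    (hirr : ∀ i j, Relation.ReflTransGen (fun a b => 0 < P a b) i j)
    {p : ι → ℝ} (hp : IsStationary P p) (h : ι → ℝ) :
    ∃ g : ι → ℝ, ∀ i, g i - (P *ᵥ g) i = h i - p ⬝ᵥ h := by
  obtain ⟨-, hp1, hpP⟩ := hp
  have hp1' : ∀ a : ℝ, p ⬝ᵥ (fun _ => a) = a := by
    intro a
    simp [dotProduct, ← Finset.sum_mul, hp1]
  -- The term `p ⬝ᵥ g` removes the kernel of `1 - P`, the constants. In finite dimension the
  -- injective `T` is onto, and `p ⬝ᵥ T g = p ⬝ᵥ g` identifies the extra term in `T g = h` as `p ⬝ᵥ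
  -- h`.
  let T : (ι → ℝ) →ₗ[ℝ] (ι → ℝ) :=
    { toFun := fun g i => g i - (P *ᵥ g) i + p ⬝ᵥ g
      map_add' := fun x y => by
        ext i
        simp only [Matrix.mulVec_add, dotProduct_add, Pi.add_apply]
        ring
      map_smul' := fun a x => by
        ext i
        simp only [Matrix.mulVec_smul, dotProduct_smul, Pi.smul_apply, smul_eq_mul,
          RingHom.id_apply]
        ring }
  have hpT : ∀ g, p ⬝ᵥ T g = p ⬝ᵥ g := by
    intro g
    have : T g = g - P *ᵥ g + fun _ => p ⬝ᵥ g := rfl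
    rw [this, dotProduct_add, dotProduct_sub, Matrix.dotProduct_mulVec, hpP, hp1']
    ring
  have hinj : Function.Injective T := by
    rw [← LinearMap.ker_eq_bot, LinearMap.ker_eq_bot']
    intro g hg
    have hpg : p ⬝ᵥ g = 0 := by rw [← hpT, hg, dotProduct_zero]
    have hPg : P *ᵥ g = g := by
      ext i
      have : g i - (P *ᵥ g) i + p ⬝ᵥ g = 0 := congrFun hg i
      linarith
    obtain ⟨a, ha⟩ := harmonic_const h0 h1 hirr hPg
    obtain rfl : g = fun _ => a := funext ha
    rw [hp1'] at hpg
    rw [hpg]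
    rfl
  obtain ⟨g, hg⟩ := LinearMap.injective_iff_surjective.1 hinj h
  refine ⟨g, fun i => ?_⟩
  have hi : g i - (P *ᵥ g) i + p ⬝ᵥ g = h i := congrFun hg i
  rw [← hg, hpT, hg]
  linarith

section
attribute [local instance] Matrix.linftyOpNormedRing Matrix.linftyOpNormedAlgebra

/-- A stochastic matrix has spectral radius one. -/
lemma sp_eq_one {ι : Type*} [Fintype ι] [DecidableEq ι] [Nonempty ι]
    {P : Matrix ι ι ℝ} (h0 : ∀ i j, 0 ≤ P i j) (h1 : ∀ i, ∑ j, P i j = 1) : sp P = 1 := by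
  set A := P.map (Complex.ofReal : ℝ → ℂ) with hA
  -- The operator norm for the sup norm is the largest absolute row sum, which bounds the spectral
  -- radius above; the constant eigenvector gives the bound below.
  have hnorm : ‖A‖₊ ≤ 1 := by
    rw [Matrix.linfty_opNNNorm_def]
    refine Finset.sup_le fun i _ => ?_
    rw [← NNReal.coe_le_coe]
    simp [hA, abs_of_nonneg (h0 _ _), h1]
  have hone : (1 : ℂ) ∈ spectrum ℂ A := by
    rw [spectrum.mem_iff, map_one, Matrix.isUnit_iff_isUnit_det, isUnit_iff_ne_zero, not_not]
    refine Matrix.exists_mulVec_eq_zero_iff.1 ⟨fun _ => 1, ?_, ?_⟩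
    · intro h
      exact one_ne_zero (congrFun h (Classical.arbitrary ι))
    · ext i
      have : ∑ j, (P i j : ℂ) = 1 := by exact_mod_cast h1 i
      simp [hA, Matrix.mulVec, dotProduct, this, Matrix.one_apply]
  have : spectralRadius ℂ A = 1 := by
    apply le_antisymm
    · exact (spectrum.spectralRadius_le_nnnorm A).trans (by exact_mod_cast hnorm)
    · rw [spectralRadius]
      refine le_trans ?_
        (le_iSup₂ (f := fun k (_ : k ∈ spectrum ℂ A) => (‖k‖₊ : ℝ≥0∞)) 1 hone)
      simp
  rw [sp, this, ENNReal.toReal_one]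

end

/-! ### The jump chain -/

section
variable {m : ℕ} {Q : Matrix (Fin m) (Fin m) ℝ}

/-- With at least two states, irreducibility makes some rate out of `i` positive, and the zero row
sum does the rest. The first step of a connecting path might be a loop at `i`; if no off-diagonal
entry were positive as well, nonnegativity would make the row sum positive. -/
lemma IsIrreducibleGenerator.diag_neg (hQ : IsIrreducibleGenerator Q) (hm : 2 ≤ m) (i : Fin m) :
    Q i i < 0 := by
  have : Nontrivial (Fin m) := Fin.nontrivial_iff_two_le.2 hm
  obtain ⟨j, hj⟩ := exists_ne i
  obtain ⟨k, hk, hik⟩ : ∃ k, k ≠ i ∧ 0 < Q i k := by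
    rcases Relation.ReflTransGen.cases_head (hQ.irreducible i j) with h | ⟨k, hk, -⟩
    · exact absurd h.symm hj
    · by_contra! hcon
      obtain rfl : k = i := by
        by_contra hki
        exact absurd hk (not_lt.2 (hcon k hki))
      have : ∑ l, Q k l ≥ Q k k := by
        rw [← Finset.add_sum_erase _ _ (Finset.mem_univ k)]
        have : 0 ≤ ∑ l ∈ Finset.univ.erase k, Q k l := Finset.sum_nonneg fun l hl =>
          hQ.offDiag_nonneg k l (Finset.ne_of_mem_erase hl).symm
        linarith
      rw [hQ.row_sum] at this
      linarith
  have h := hQ.row_sum i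
  rw [← Finset.add_sum_erase _ _ (Finset.mem_univ i)] at h
  have : Q i k ≤ ∑ l ∈ Finset.univ.erase i, Q i l :=
    Finset.single_le_sum (f := fun l => Q i l)
      (fun l hl => hQ.offDiag_nonneg i l (Finset.ne_of_mem_erase hl).symm)
      (Finset.mem_erase.2 ⟨hk, Finset.mem_univ _⟩)
  linarith

lemma IsIrreducibleGenerator.rate_pos (hQ : IsIrreducibleGenerator Q) (hm : 2 ≤ m) (i : Fin m) :
    0 < rate Q i :=
  abs_pos.2 (hQ.diag_neg hm i).ne

lemma IsIrreducibleGenerator.inv_rateMatrix (hQ : IsIrreducibleGenerator Q) (hm : 2 ≤ m) :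
    (rateMatrix Q)⁻¹ = Matrix.diagonal fun i => (rate Q i)⁻¹ := by
  refine Matrix.inv_eq_right_inv ?_
  rw [rateMatrix, Matrix.diagonal_mul_diagonal, ← Matrix.diagonal_one]
  congr 1
  ext i
  exact mul_inv_cancel₀ (hQ.rate_pos hm i).ne'

lemma IsIrreducibleGenerator.jumpMatrix_apply (hQ : IsIrreducibleGenerator Q) (hm : 2 ≤ m)
    (i j : Fin m) : jumpMatrix Q i j = if i = j then 0 else (rate Q i)⁻¹ * Q i j := by
  rw [jumpMatrix, hQ.inv_rateMatrix hm, Matrix.add_apply, Matrix.diagonal_mul, Matrix.one_apply]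
  split_ifs with h
  · subst h
    have := hQ.diag_neg hm i
    rw [rate, abs_of_neg this, inv_neg, neg_mul, inv_mul_cancel₀ this.ne]
    ring
  · ring

lemma IsIrreducibleGenerator.jumpMatrix_nonneg (hQ : IsIrreducibleGenerator Q) (hm : 2 ≤ m)
    (i j : Fin m) : 0 ≤ jumpMatrix Q i j := by
  rw [hQ.jumpMatrix_apply hm]
  split_ifs with h
  · exact le_rfl
  · exact mul_nonneg (inv_nonneg.2 (hQ.rate_pos hm i).le) (hQ.offDiag_nonneg i j h)

lemma IsIrreducibleGenerator.jumpMatrix_row_sum (hQ : IsIrreducibleGenerator Q) (hm : 2 ≤ m)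
    (i : Fin m) : ∑ j, jumpMatrix Q i j = 1 := by
  rw [jumpMatrix, hQ.inv_rateMatrix hm]
  simp [Matrix.one_apply, Finset.sum_add_distrib, ← Finset.mul_sum, hQ.row_sum]

lemma IsIrreducibleGenerator.jumpMatrix_irreducible (hQ : IsIrreducibleGenerator Q) (hm : 2 ≤ m)
    (i j : Fin m) : Relation.ReflTransGen (fun a b => 0 < jumpMatrix Q a b) i j := by
  refine Relation.ReflTransGen.mono (fun a b hab => ?_) _ _ (hQ.irreducible i j)
  rw [hQ.jumpMatrix_apply hm, if_neg]
  · exact mul_pos (inv_pos.2 (hQ.rate_pos hm a)) hab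
  · rintro rfl
    exact lt_asymm hab (hQ.diag_neg hm a)

lemma IsIrreducibleGenerator.isStationary_piHat (hQ : IsIrreducibleGenerator Q) (hm : 2 ≤ m) :
    IsStationary (jumpMatrix Q) (piHat Q) :=
  have : Nonempty (Fin m) := ⟨⟨0, by omega⟩⟩
  isStationary_stationary (hQ.jumpMatrix_nonneg hm) (hQ.jumpMatrix_row_sum hm)

lemma IsIrreducibleGenerator.meanRate_eq (hQ : IsIrreducibleGenerator Q) (hm : 2 ≤ m) {r : ℕ}
    (Om : Fin m → Matrix (Fin r) (Fin r) ℝ) :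
    meanRate Q Om = piHat Q ⬝ᵥ fun l => lam Om l / rate Q l := by
  rw [meanRate, hQ.inv_rateMatrix hm]
  congr 1
  ext l
  rw [Matrix.mulVec_diagonal, div_eq_inv_mul]

end

/-! ### Processes with a single type -/

lemma maxRealPart_unique (A : Matrix (Fin 1) (Fin 1) ℝ) : maxRealPart A = A 0 0 := by
  have : A.map (Complex.ofReal : ℝ → ℂ) = algebraMap ℂ _ (A 0 0 : ℂ) := by
    ext i j
    fin_cases i
    fin_cases j
    simp [Matrix.algebraMap_matrix_apply]
  rw [maxRealPart, this, spectrum.scalar_eq]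
  simp

/-- `leftVec` is an `epsilon` choice, so a witness is exhibited first; the normalisation alone then
determines the single entry. -/
lemma leftVec_unique (A : Matrix (Fin 1) (Fin 1) ℝ) : leftVec A = 1 := by
  have h : ∃ u : Fin 1 → ℝ, (∀ i, 0 < u i) ∧ u ᵥ* A = maxRealPart A • u ∧ ∑ i, u i = 1 := by
    refine ⟨1, fun _ => one_pos, ?_, by simp⟩
    ext i
    fin_cases i
    simp [Matrix.vecMul, dotProduct, maxRealPart_unique]
  have := (Classical.epsilon_spec h).2.2
  ext i
  fin_cases i
  simpa [leftVec] using this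

lemma rightVec_unique (A : Matrix (Fin 1) (Fin 1) ℝ) : rightVec A = 1 := by
  have h : ∃ v : Fin 1 → ℝ,
      (∀ i, 0 < v i) ∧ A *ᵥ v = maxRealPart A • v ∧ leftVec A ⬝ᵥ v = 1 := by
    refine ⟨1, fun _ => one_pos, ?_, by simp [leftVec_unique]⟩
    ext i
    fin_cases i
    simp [Matrix.mulVec, dotProduct, maxRealPart_unique]
  have : leftVec A ⬝ᵥ rightVec A = 1 := (Classical.epsilon_spec h).2.2
  ext i
  fin_cases i
  rw [leftVec_unique, one_dotProduct] at this
  simpa using this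

section
variable {m : ℕ} {Q : Matrix (Fin m) (Fin m) ℝ} (Om : Fin m → Matrix (Fin 1) (Fin 1) ℝ)

lemma OmStar_unique (l : Fin m) : OmStar Om l = 0 := by
  ext i j
  fin_cases i
  fin_cases j
  simp [OmStar, lam, maxRealPart_unique]

lemma Theta_unique (l : Fin m) : Theta Om l = 0 := by
  simp [Theta, OmStar_unique]

lemma Theta'_unique (l : Fin m) : Theta' Om l = 0 := by
  simp [Theta', OmStar_unique]

lemma smul_inv_smul_one {n : ℕ} {c : ℝ} (hc : c ≠ 0) :
    c • (c • (1 : Matrix (Fin n) (Fin n) ℝ))⁻¹ = 1 := by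
  rw [Matrix.inv_eq_right_inv (B := c⁻¹ • 1) (by simp [smul_smul, hc]), smul_smul,
    mul_inv_cancel₀ hc, one_smul]

lemma NBlock_unique {l : Fin m} (hc : rate Q l ≠ 0) : NBlock Q Om l = 1 := by
  rw [NBlock, Theta_unique, sub_zero, smul_inv_smul_one hc]

lemma NTildeBlock_unique {l : Fin m} (hc : rate Q l ≠ 0) : NTildeBlock Q Om l = 1 := by
  rw [NTildeBlock, Theta'_unique, sub_zero, smul_inv_smul_one hc]

lemma MBlock_unique {l : Fin m} (hc : rate Q l ≠ 0) : MBlock Q Om l = 1 := by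
  rw [MBlock, Theta_unique, sub_zero, Del, rightVec_unique, Pi.one_def, Matrix.diagonal_one,
    inv_one, one_mul, mul_one, smul_inv_smul_one hc]

lemma blockDiag_one {r : ℕ} : blockDiag (fun _ : Fin m => (1 : Matrix (Fin r) (Fin r) ℝ)) = 1 := by
  ext p q
  simp only [blockDiag, Matrix.of_apply, Matrix.one_apply, Prod.ext_iff]
  split_ifs <;> simp_all

lemma omegaL_unique (hc : ∀ l, rate Q l ≠ 0) : omegaL Q Om = meanRate Q Om := by
  have : NBlock Q Om = fun _ => 1 := funext fun l => NBlock_unique Om (hc l)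
  rw [omegaL, this, blockDiag_one]
  simp

lemma omegaLTilde_unique (hc : ∀ l, rate Q l ≠ 0) : omegaLTilde Q Om = meanRate Q Om := by
  have : NTildeBlock Q Om = fun _ => 1 := funext fun l => NTildeBlock_unique Om (hc l)
  rw [omegaLTilde, this, blockDiag_one]
  simp

lemma omegaU_unique (hm : 2 ≤ m) (hQ : IsIrreducibleGenerator Q) :
    omegaU Q Om = meanRate Q Om := by
  have hM : MBlock Q Om = fun _ => 1 := funext fun l => MBlock_unique Om (hQ.rate_pos hm l).ne'
  have : Nonempty (Fin m) := ⟨⟨0, by omega⟩⟩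
  rw [omegaU, hM, blockDiag_one, one_mul, sp_eq_one, Real.log_one, add_zero]
  · intro p q
    rw [Matrix.kronecker_apply]
    exact mul_nonneg (hQ.jumpMatrix_nonneg hm _ _) (by rw [Matrix.one_apply]; positivity)
  · intro p
    simp [Fintype.sum_prod_type, hQ.jumpMatrix_row_sum hm, Matrix.one_apply,
      eq_iff_true_of_subsingleton]

/-- There is a single path `phi`, with `RZero` and conditional probability both 1, so the integrand
vanishes for every value of the sojourn times. -/
lemma omegaLStar_unique : omegaLStar Q Om = meanRate Q Om := by
  have : ∀ i j z, condR Om i j z = 1 := by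
    intro i j z
    have hR : ∀ phi, RZero Om phi = 1 := fun phi => by simp [RZero, rightVec_unique]
    have hp : ∀ phi, pathProb Om z phi = 1 := fun phi => by
      refine Finset.prod_eq_one fun k _ => ?_
      simp [Theta_unique, Matrix.one_apply, eq_iff_true_of_subsingleton]
    simp only [condR, hR, hp, one_mul]
    refine div_self ?_
    rw [Finset.sum_const, Finset.filter_true_of_mem fun _ _ =>
      ⟨Subsingleton.elim _ _, Subsingleton.elim _ _⟩]
    simp
  simp [omegaLStar, this]

end

/-! ### A law of large numbers for orthogonal sequences -/

/-- By Tonelli the sum of the `f n` has finite integral, hence is finite almost everywhere, and the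
terms of a convergent series tend to zero. -/
lemma ae_tendsto_zero_of_summable_integral {S : Type*} [MeasurableSpace S] {μ : Measure S}
    {f : ℕ → S → ℝ} (hf : ∀ n, Integrable (f n) μ) (h0 : ∀ n a, 0 ≤ f n a)
    (hs : Summable fun n => ∫ a, f n a ∂μ) :
    ∀ᵐ a ∂μ, Tendsto (fun n => f n a) atTop (𝓝 0) := by
  have hint : ∫⁻ a, ∑' n, ENNReal.ofReal (f n a) ∂μ ≠ ∞ := by
    rw [lintegral_tsum fun n => (hf n).aemeasurable.ennreal_ofReal]
    have : ∀ n, ∫⁻ a, ENNReal.ofReal (f n a) ∂μ = ENNReal.ofReal (∫ a, f n a ∂μ) := fun n =>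
      (ofReal_integral_eq_lintegral_ofReal (hf n) (ae_of_all _ (h0 n))).symm
    simp_rw [this]
    exact hs.tsum_ofReal_ne_top
  filter_upwards [ae_lt_top' (AEMeasurable.tsum fun n =>
    (hf n).aemeasurable.ennreal_ofReal) hint] with a ha
  have := (ENNReal.tendsto_toReal ENNReal.zero_ne_top).comp
    (ENNReal.tendsto_atTop_zero_of_tsum_ne_top ha.ne)
  refine this.congr fun n => ?_
  exact ENNReal.toReal_ofReal (h0 n a)

lemma integral_sum_sq_le {S : Type*} [MeasurableSpace S] {μ : Measure S} {D : ℕ → S → ℝ}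
    (hD : ∀ k, MemLp (D k) 2 μ) (horth : ∀ j k, j < k → ∫ a, D j a * D k a ∂μ = 0)
    {C : ℝ} (hC : ∀ k, ∫ a, D k a ^ 2 ∂μ ≤ C) (n : ℕ) :
    ∫ a, (∑ k ∈ Finset.range n, D k a) ^ 2 ∂μ ≤ n * C := by
  induction n with
  | zero => simp
  | succ n ih =>
    have hT : MemLp (fun a => ∑ k ∈ Finset.range n, D k a) 2 μ :=
      memLp_finsetSum _ fun k _ => hD k
    have hcross : ∫ a, (∑ k ∈ Finset.range n, D k a) * D n a ∂μ = 0 := by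
      have hi : ∀ k, Integrable (fun a => D k a * D n a) μ := fun k => (hD k).integrable_mul (hD n)
      simp_rw [Finset.sum_mul]
      rw [integral_finsetSum _ fun k _ => hi k]
      exact Finset.sum_eq_zero fun k hk => horth k n (Finset.mem_range.1 hk)
    have hexp : ∀ a, (∑ k ∈ Finset.range (n + 1), D k a) ^ 2 =
        (∑ k ∈ Finset.range n, D k a) ^ 2 + 2 * ((∑ k ∈ Finset.range n, D k a) * D n a) +
          D n a ^ 2 := by
      intro a
      rw [Finset.sum_range_succ]
      ring
    simp_rw [hexp]
    have hTD : Integrable (fun a => (∑ k ∈ Finset.range n, D k a) * D n a) μ :=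
      hT.integrable_mul (hD n)
    have hTD' : Integrable (fun a => (∑ k ∈ Finset.range n, D k a) ^ 2 +
        2 * ((∑ k ∈ Finset.range n, D k a) * D n a)) μ := hT.integrable_sq.add (hTD.const_mul 2)
    rw [integral_add hTD' (hD n).integrable_sq,
      integral_add hT.integrable_sq (hTD.const_mul 2), integral_const_mul, hcross]
    push_cast
    linarith [hC n]

/-- The averages of an orthogonal sequence with bounded second moments converge to zero
almost surely. -/
theorem ae_tendsto_average_of_orthogonal {S : Type*} [MeasurableSpace S] {μ : Measure S}
    {D : ℕ → S → ℝ} (hD : ∀ k, MemLp (D k) 2 μ)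
    (horth : ∀ j k, j < k → ∫ a, D j a * D k a ∂μ = 0)
    {C : ℝ} (hC : ∀ k, ∫ a, D k a ^ 2 ∂μ ≤ C) :
    ∀ᵐ a ∂μ, Tendsto (fun n : ℕ => (∑ k ∈ Finset.range n, D k a) / n) atTop (𝓝 0) := by
  have hC0 : 0 ≤ C := (integral_nonneg fun a => sq_nonneg (D 0 a)).trans (hC 0)
  let T : ℕ → S → ℝ := fun n a => ∑ k ∈ Finset.range n, D k a
  -- The partial sums are controlled along the squares `n ^ 2`. By Cauchy–Schwarz, `V n` dominates
  -- the square of every partial sum over the block from `n ^ 2` to `(n + 1) ^ 2`, which has `2 * n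
  -- + 1` terms.
  let V : ℕ → S → ℝ := fun n a =>
    (2 * n + 1 : ℕ) * ∑ k ∈ Finset.Ico (n ^ 2) ((n + 1) ^ 2), D k a ^ 2
  let W : ℕ → S → ℝ := fun n a => (T (n ^ 2) a ^ 2 + V n a) / n ^ 4
  have hcard : ∀ n : ℕ, (Finset.Ico (n ^ 2) ((n + 1) ^ 2)).card = 2 * n + 1 := by
    intro n
    rw [Nat.card_Ico, show (n + 1) ^ 2 = n ^ 2 + (2 * n + 1) by ring, Nat.add_sub_cancel_left]
  have hTi : ∀ n, Integrable (fun a => T n a ^ 2) μ := fun n =>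
    (memLp_finsetSum _ fun k _ => hD k).integrable_sq
  have hVi : ∀ n, Integrable (V n) μ := fun n =>
    (integrable_finsetSum _ fun k _ => (hD k).integrable_sq).const_mul _
  have hWi : ∀ n, Integrable (W n) μ := fun n => ((hTi _).add (hVi n)).div_const _
  have hV0 : ∀ n a, 0 ≤ V n a := fun n a =>
    mul_nonneg (Nat.cast_nonneg _) (Finset.sum_nonneg fun k _ => sq_nonneg _)
  have hW0 : ∀ n a, 0 ≤ W n a := fun n a =>
    div_nonneg (add_nonneg (sq_nonneg _) (hV0 n a)) (by positivity)
  have hVint : ∀ n, ∫ a, V n a ∂μ ≤ (2 * n + 1) ^ 2 * C := by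
    intro n
    rw [integral_const_mul, integral_finsetSum _ fun k _ => (hD k).integrable_sq]
    have : ∑ k ∈ Finset.Ico (n ^ 2) ((n + 1) ^ 2), ∫ a, D k a ^ 2 ∂μ ≤ (2 * n + 1 : ℕ) * C := by
      refine (Finset.sum_le_card_nsmul _ _ C fun k _ => hC k).trans ?_
      rw [hcard, nsmul_eq_mul]
    refine (mul_le_mul_of_nonneg_left this (Nat.cast_nonneg _)).trans (le_of_eq ?_)
    push_cast
    ring
  -- The constant is `1 + 9`: one from `T (n ^ 2)`, nine from `(2 * n + 1) ^ 2 ≤ 9 * n ^ 2`. At `n =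
  -- 0` both sides are zero, since division by zero gives zero.
  have hWint : ∀ n, ∫ a, W n a ∂μ ≤ 10 * C * (1 / (n : ℝ) ^ 2) := by
    intro n
    rw [integral_div, integral_add (hTi _) (hVi n)]
    rcases Nat.eq_zero_or_pos n with rfl | hn
    · simp
    have hn1 : (1 : ℝ) ≤ n := by exact_mod_cast hn
    have h1 : ∫ a, T (n ^ 2) a ^ 2 ∂μ ≤ (n ^ 2 : ℕ) * C := integral_sum_sq_le hD horth hC _
    push_cast at h1
    rw [div_le_iff₀ (by positivity)]
    have h2 : 10 * C * (1 / (n : ℝ) ^ 2) * n ^ 4 = 10 * n ^ 2 * C := by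
      field_simp
    rw [h2]
    have h3 : ((2 * n + 1 : ℝ)) ^ 2 ≤ 9 * n ^ 2 := by nlinarith
    nlinarith [hVint n, mul_le_mul_of_nonneg_right h3 hC0]
  have hsum : Summable fun n => ∫ a, W n a ∂μ :=
    Summable.of_nonneg_of_le (fun n => integral_nonneg (hW0 n)) hWint
      ((Real.summable_one_div_nat_pow.2 one_lt_two).mul_left _)
  filter_upwards [ae_tendsto_zero_of_summable_integral hWi hW0 hsum] with a ha
  have hsqrt : Tendsto Nat.sqrt atTop atTop :=
    tendsto_atTop.2 fun b => (eventually_ge_atTop (b ^ 2)).mono fun n hn => by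
      rw [Nat.le_sqrt]
      nlinarith
  have hlim : Tendsto (fun N : ℕ => 2 * W (Nat.sqrt N) a) atTop (𝓝 0) := by
    simpa using (ha.comp hsqrt).const_mul 2
  have hsq : Tendsto (fun N : ℕ => (T N a / N) ^ 2) atTop (𝓝 0) := by
    refine squeeze_zero' (Eventually.of_forall fun _ => sq_nonneg _) ?_ hlim
    filter_upwards [eventually_ge_atTop 1] with N hN
    set n := Nat.sqrt N with hn
    have hn1 : 1 ≤ n := by rw [hn, Nat.le_sqrt]; omega
    have hnN : n ^ 2 ≤ N := by rw [sq]; exact Nat.sqrt_le N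
    have hNn : N < (n + 1) ^ 2 := by rw [sq]; exact Nat.lt_succ_sqrt N
    have hsplit : T N a = T (n ^ 2) a + ∑ k ∈ Finset.Ico (n ^ 2) N, D k a :=
      (Finset.sum_range_add_sum_Ico _ hnN).symm
    have hgap : (∑ k ∈ Finset.Ico (n ^ 2) N, D k a) ^ 2 ≤ V n a := by
      refine (sq_sum_le_card_mul_sum_sq).trans ?_
      have hsub : Finset.Ico (n ^ 2) N ⊆ Finset.Ico (n ^ 2) ((n + 1) ^ 2) :=
        Finset.Ico_subset_Ico_right hNn.le
      refine mul_le_mul ?_ ?_ (Finset.sum_nonneg fun _ _ => sq_nonneg _) (Nat.cast_nonneg _)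
      · rw [← hcard n]
        exact_mod_cast Finset.card_le_card hsub
      · exact Finset.sum_le_sum_of_subset_of_nonneg hsub fun _ _ _ => sq_nonneg _
    have hT2 : T N a ^ 2 ≤ 2 * (T (n ^ 2) a ^ 2 + V n a) := by
      rw [hsplit]
      nlinarith [sq_nonneg (T (n ^ 2) a - ∑ k ∈ Finset.Ico (n ^ 2) N, D k a)]
    have hn0 : (0 : ℝ) < n := by exact_mod_cast hn1
    have hpow : (n : ℝ) ^ 4 ≤ (N : ℝ) ^ 2 := by
      have : (n : ℝ) ^ 2 ≤ N := by exact_mod_cast hnN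
      nlinarith [sq_nonneg (n : ℝ)]
    calc (T N a / N) ^ 2 = T N a ^ 2 / (N : ℝ) ^ 2 := div_pow _ _ _
      _ ≤ T N a ^ 2 / (n : ℝ) ^ 4 := by gcongr
      _ ≤ 2 * (T (n ^ 2) a ^ 2 + V n a) / (n : ℝ) ^ 4 := by gcongr
      _ = 2 * W n a := by simp only [W]; ring
  have habs := hsq.sqrt
  simp_rw [Real.sqrt_sq_eq_abs, Real.sqrt_zero] at habs
  exact (tendsto_zero_iff_abs_tendsto_zero _).2 habs

/-! ### Moments of the exponential distribution -/

lemma measurable_gammaPDF (c : ℝ) : Measurable (gammaPDF 1 c) :=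
  (measurable_gammaPDFReal 1 c).ennreal_ofReal

lemma integrable_pow_expMeasure {c : ℝ} (hc : 0 < c) (n : ℕ) :
    Integrable (fun x : ℝ => x ^ n) (expMeasure c) := by
  rw [expMeasure, gammaMeasure, integrable_withDensity_iff_integrable_smul'
    (measurable_gammaPDF c)
    (ae_of_all _ fun x => ENNReal.ofReal_lt_top)]
  have hI : IntegrableOn (fun x : ℝ => x ^ ((n + 1 : ℝ) - 1) * Real.exp (-(c * x)))
      (Set.Ioi 0) := by
    -- A function that is not integrable has integral zero by convention, so the positive value of
    -- the Gamma integral proves integrability.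
    refine not_imp_comm.1 integral_undef ?_
    rw [Real.integral_rpow_mul_exp_neg_mul_Ioi (by positivity) hc]
    have : 0 < Real.Gamma (n + 1 : ℝ) := Real.Gamma_pos_of_pos (by positivity)
    positivity
  have hI' := (integrable_indicator_iff measurableSet_Ici).2
    ((integrableOn_Ici_iff_integrableOn_Ioi).2 (hI.const_mul c))
  refine hI'.congr (ae_of_all _ fun x => ?_)
  simp only [Set.indicator_apply, Set.mem_Ici, smul_eq_mul]
  change _ = (exponentialPDF c x).toReal * x ^ n
  rw [exponentialPDF_eq]
  split_ifs with hx
  · rw [ENNReal.toReal_ofReal (by positivity), add_sub_cancel_right, Real.rpow_natCast]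
    ring
  · simp

lemma integral_expMeasure {c : ℝ} (hc : 0 < c) : ∫ x, x ∂(expMeasure c) = c⁻¹ := by
  rw [expMeasure, gammaMeasure, integral_withDensity_eq_integral_toReal_smul
    (measurable_gammaPDF c)
    (ae_of_all _ fun x => ENNReal.ofReal_lt_top)]
  have : ∀ x : ℝ, (gammaPDF 1 c x).toReal • x =
      (Set.Ici 0).indicator (fun x : ℝ => c * (x ^ ((2 : ℝ) - 1) * Real.exp (-(c * x)))) x := by
    intro x
    simp only [Set.indicator_apply, Set.mem_Ici, smul_eq_mul]
    change (exponentialPDF c x).toReal * x = _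
    rw [exponentialPDF_eq]
    split_ifs with hx
    · rw [ENNReal.toReal_ofReal (by positivity), show (2 : ℝ) - 1 = 1 by norm_num, Real.rpow_one]
      ring
    · simp
  simp_rw [this]
  rw [integral_indicator measurableSet_Ici, integral_Ici_eq_integral_Ioi, integral_const_mul,
    Real.integral_rpow_mul_exp_neg_mul_Ioi two_pos hc, Real.Gamma_two]
  rw [Real.rpow_two]
  field_simp

lemma integrable_centred_expMeasure {c : ℝ} (hc : 0 < c) (b : ℝ) :
    Integrable (fun x => b * (x - c⁻¹)) (expMeasure c) := by
  have := isProbabilityMeasure_expMeasure hc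
  have h1 := integrable_pow_expMeasure hc 1
  simp only [pow_one] at h1
  exact (h1.sub (integrable_const _)).const_mul b

lemma integral_centred_expMeasure {c : ℝ} (hc : 0 < c) (b : ℝ) :
    ∫ x, b * (x - c⁻¹) ∂expMeasure c = 0 := by
  have := isProbabilityMeasure_expMeasure hc
  have h1 := integrable_pow_expMeasure hc 1
  simp only [pow_one] at h1
  rw [integral_const_mul, integral_sub h1 (integrable_const _), integral_expMeasure hc]
  simp

lemma integrable_centred_sq_expMeasure {c : ℝ} (hc : 0 < c) (b : ℝ) :
    Integrable (fun x => (b * (x - c⁻¹)) ^ 2) (expMeasure c) := by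
  have := isProbabilityMeasure_expMeasure hc
  have h1 := integrable_pow_expMeasure hc 1
  have h2 := integrable_pow_expMeasure hc 2
  simp only [pow_one] at h1
  refine (((h2.sub (h1.const_mul (2 * c⁻¹))).add
    (integrable_const (c⁻¹ ^ 2))).const_mul (b ^ 2)).congr (ae_of_all _ fun x => ?_)
  simp only [Pi.add_apply, Pi.sub_apply]
  ring

/-! ### Markov chains with exponential holding times -/

/-- `Y` is a Markov chain with the stochastic transition matrix `P` and, conditionally on `Y`,
the times `ξ` are independent and exponentially distributed with parameters `c (Y k)`. -/
structure IsMarkovHolding {ι : Type*} [Fintype ι] [MeasurableSpace ι]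
    {S : Type*} [MeasurableSpace S] (μ : Measure S) (P : Matrix ι ι ℝ) (c : ι → ℝ)
    (Y : ℕ → S → ι) (ξ : ℕ → S → ℝ) : Prop where
  nonneg : ∀ i j, 0 ≤ P i j
  row_sum : ∀ i, ∑ j, P i j = 1
  rate_pos : ∀ i, 0 < c i
  measurable_state : ∀ k, Measurable (Y k)
  measurable_time : ∀ k, Measurable (ξ k)
  law : ∀ (n : ℕ) (x : ℕ → ι) (B : ℕ → Set ℝ), (∀ k, MeasurableSet (B k)) →
    μ {a | ∀ k ≤ n, Y k a = x k ∧ ξ k a ∈ B k} =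
      μ {a | Y 0 a = x 0} * (∏ k ∈ Finset.range n, ENNReal.ofReal (P (x k) (x (k + 1)))) *
        ∏ k ∈ Finset.range (n + 1), expMeasure (c (x k)) (B k)

/-- The sum of a measure over the fibres of a measurable map to a finite type. -/
lemma measure_eq_sum_fiber {κ S : Type*} [Fintype κ] [MeasurableSpace κ]
    [MeasurableSingletonClass κ] [MeasurableSpace S] (μ : Measure S) {F : S → κ}
    (hF : Measurable F) (E : Set S) : μ E = ∑ x, μ (E ∩ F ⁻¹' {x}) := by
  -- Restricting to `E` and measuring the fibres needs only the fibres to be measurable, so `E` can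
  -- be arbitrary.
  have h : ∀ x, μ (E ∩ F ⁻¹' {x}) = μ.restrict E (F ⁻¹' {x}) := fun x => by
    rw [Measure.restrict_apply (hF (measurableSet_singleton x)), Set.inter_comm]
  simp_rw [h]
  rw [sum_measure_preimage_singleton _ fun x _ => hF (measurableSet_singleton x)]
  simp

lemma pairwise_disjoint_fiber {κ S : Type*} (F : S → κ) :
    Pairwise (Function.onFun Disjoint fun x => F ⁻¹' {x}) := fun x y hxy =>
  Set.disjoint_left.2 fun _ (ha : _ = x) (hb : _ = y) => hxy (ha.symm.trans hb)

lemma iUnion_fiber {κ S : Type*} (F : S → κ) : ⋃ x, F ⁻¹' {x} = Set.univ :=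
  Set.eq_univ_of_forall fun a => Set.mem_iUnion.2 ⟨F a, rfl⟩

/-- An integral as a sum over the fibres of a measurable map to a finite type. -/
lemma integral_eq_sum_fiber {κ S : Type*} [Fintype κ] [MeasurableSpace κ]
    [MeasurableSingletonClass κ] [MeasurableSpace S] {μ : Measure S} {F : S → κ}
    (hF : Measurable F) {h : S → ℝ} (hh : ∀ x, IntegrableOn h (F ⁻¹' {x}) μ) :
    ∫ a, h a ∂μ = ∑ x, ∫ a in F ⁻¹' {x}, h a ∂μ := by
  rw [← setIntegral_univ, ← iUnion_fiber F]
  exact integral_iUnion_fintype (fun x => hF (measurableSet_singleton x))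
    (pairwise_disjoint_fiber F) hh

lemma integrable_of_fiber {κ S : Type*} [Fintype κ] [MeasurableSpace S] {μ : Measure S}
    (F : S → κ) {h : S → ℝ} (hh : ∀ x, IntegrableOn h (F ⁻¹' {x}) μ) : Integrable h μ := by
  rw [← integrableOn_univ, ← iUnion_fiber F]
  exact integrableOn_finite_iUnion.2 hh

namespace IsMarkovHolding

variable {ι : Type*} [Fintype ι] [MeasurableSpace ι]
  {S : Type*} [MeasurableSpace S] {μ : Measure S} {P : Matrix ι ι ℝ} {c : ι → ℝ}
  {Y : ℕ → S → ι} {ξ : ℕ → S → ℝ}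

lemma measure_path_inter (H : IsMarkovHolding μ P c Y ξ) (n : ℕ) (x : ℕ → ι) {B : ℕ → Set ℝ}
    (hB : ∀ k, MeasurableSet (B k)) :
    μ {a | ∀ k ≤ n, Y k a = x k ∧ ξ k a ∈ B k} =
      μ {a | ∀ k ≤ n, Y k a = x k} *
        ∏ k ∈ Finset.range (n + 1), expMeasure (c (x k)) (B k) := by
  have h := H.law n x (fun _ => Set.univ) fun _ => MeasurableSet.univ
  have h1 : ∏ k ∈ Finset.range (n + 1), expMeasure (c (x k)) Set.univ = 1 :=
    Finset.prod_eq_one fun k _ =>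
      (isProbabilityMeasure_expMeasure (H.rate_pos (x k))).measure_univ
  simp only [Set.mem_univ, and_true, h1, mul_one] at h
  rw [H.law n x B hB, h]

lemma measure_path (H : IsMarkovHolding μ P c Y ξ) (n : ℕ) (x : ℕ → ι) :
    μ {a | ∀ k ≤ n, Y k a = x k} =
      μ {a | Y 0 a = x 0} * ∏ k ∈ Finset.range n, ENNReal.ofReal (P (x k) (x (k + 1))) := by
  have h := H.law n x (fun _ => Set.univ) fun _ => MeasurableSet.univ
  have h1 : ∏ k ∈ Finset.range (n + 1), expMeasure (c (x k)) Set.univ = 1 :=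
    Finset.prod_eq_one fun k _ =>
      (isProbabilityMeasure_expMeasure (H.rate_pos (x k))).measure_univ
  simpa only [Set.mem_univ, and_true, h1, mul_one] using h

variable [MeasurableSingletonClass ι]

/-- The sum of a measure over the initial segments of the chain. -/
lemma measure_eq_sum_path (H : IsMarkovHolding μ P c Y ξ) (n : ℕ) (E : Set S) :
    μ E = ∑ x : Fin (n + 1) → ι, μ (E ∩ {a | ∀ k ≤ n, Y k a = x (Fin.ofNat (n + 1) k)}) := by
  rw [measure_eq_sum_fiber μ (F := fun a (k : Fin (n + 1)) => Y k a)
    (measurable_pi_lambda _ fun k => H.measurable_state k)]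
  refine Finset.sum_congr rfl fun x _ => ?_
  congr 2
  ext a
  simp only [Set.mem_preimage, Set.mem_singleton_iff, Set.mem_ofPred_eq]
  constructor
  · rintro rfl k hk
    simp [Nat.mod_eq_of_lt (Nat.lt_succ_of_le hk)]
  · intro h
    ext k
    simpa using h k (Nat.le_of_lt_succ k.2)

/-- Given the states at two different times, the holding times are independent and exponential. -/
lemma measure_pair (H : IsMarkovHolding μ P c Y ξ) {j k : ℕ} (hjk : j < k) (i l : ι)
    {U V : Set ℝ} (hU : MeasurableSet U) (hV : MeasurableSet V) :
    μ ({a | Y j a = i ∧ Y k a = l} ∩ {a | ξ j a ∈ U ∧ ξ k a ∈ V}) =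
      μ {a | Y j a = i ∧ Y k a = l} * expMeasure (c i) U * expMeasure (c l) V := by
  rw [H.measure_eq_sum_path k, H.measure_eq_sum_path k {a | Y j a = i ∧ Y k a = l}, mul_assoc,
    Finset.sum_mul]
  refine Finset.sum_congr rfl fun x _ => ?_
  set y : ℕ → ι := fun s => x (Fin.ofNat (k + 1) s)
  by_cases hy : y j = i ∧ y k = l
  · obtain ⟨hi, hl⟩ := hy
    -- Along one fixed path only the holding times at `j` and `k` are constrained; all other factors
    -- of the law are total masses equal to 1.
    let B : ℕ → Set ℝ := fun s => if s = j then U else if s = k then V else Set.univ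
    have hB : ∀ s, MeasurableSet (B s) := by
      intro s
      dsimp only [B]
      split_ifs
      exacts [hU, hV, MeasurableSet.univ]
    have hBj : B j = U := if_pos rfl
    have hBk : B k = V := by rw [← if_pos (c := k = k) rfl (t := V)]; exact if_neg hjk.ne'
    have hprod : ∏ s ∈ Finset.range (k + 1), expMeasure (c (y s)) (B s) =
        expMeasure (c i) U * expMeasure (c l) V := by
      rw [Finset.prod_eq_mul j k hjk.ne, hBj, hBk, hi, hl]
      · rintro s - ⟨hsj, hsk⟩
        have : B s = Set.univ := by simp only [B, if_neg hsj, if_neg hsk]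
        rw [this]
        exact (isProbabilityMeasure_expMeasure (H.rate_pos (y s))).measure_univ
      · intro h
        exact absurd (Finset.mem_range.2 (by omega)) h
      · intro h
        exact absurd (Finset.mem_range.2 (by omega)) h
    have h1 : {a | Y j a = i ∧ Y k a = l} ∩ {a | ξ j a ∈ U ∧ ξ k a ∈ V} ∩
        {a | ∀ s ≤ k, Y s a = y s} = {a | ∀ s ≤ k, Y s a = y s ∧ ξ s a ∈ B s} := by
      ext a
      simp only [Set.mem_inter_iff, Set.mem_ofPred_eq]
      constructor
      · rintro ⟨⟨-, hu, hv⟩, h⟩ s hs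
        refine ⟨h s hs, ?_⟩
        dsimp only [B]
        split_ifs with h1 h2
        exacts [h1 ▸ hu, h2 ▸ hv, Set.mem_univ _]
      · intro h
        exact ⟨⟨⟨hi ▸ (h j hjk.le).1, hl ▸ (h k le_rfl).1⟩, hBj ▸ (h j hjk.le).2,
          hBk ▸ (h k le_rfl).2⟩, fun s hs => (h s hs).1⟩
    have h2 : {a | Y j a = i ∧ Y k a = l} ∩ {a | ∀ s ≤ k, Y s a = y s} =
        {a | ∀ s ≤ k, Y s a = y s} :=
      Set.inter_eq_right.2 fun a ha => ⟨(ha j hjk.le).trans hi, (ha k le_rfl).trans hl⟩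
    rw [h1, h2, H.measure_path_inter k y hB, hprod]
  · have h2 : {a | Y j a = i ∧ Y k a = l} ∩ {a | ∀ s ≤ k, Y s a = y s} = ∅ := by
      refine Set.eq_empty_of_forall_notMem fun a ha => hy ?_
      exact ⟨(ha.2 j hjk.le).symm.trans ha.1.1, (ha.2 k le_rfl).symm.trans ha.1.2⟩
    rw [Set.inter_right_comm, h2, Set.empty_inter, measure_empty, zero_mul]

/-- The Markov property of the chain. -/
lemma measure_step (H : IsMarkovHolding μ P c Y ξ) (k : ℕ) (p : (Fin (k + 1) → ι) → Prop)
    (l l' : ι) :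
    μ {a | (p (fun s => Y s a) ∧ Y k a = l) ∧ Y (k + 1) a = l'} =
      μ {a | p (fun s => Y s a) ∧ Y k a = l} * ENNReal.ofReal (P l l') := by
  classical
  rw [H.measure_eq_sum_path k, H.measure_eq_sum_path k {a | p (fun s => Y s a) ∧ Y k a = l},
    Finset.sum_mul]
  refine Finset.sum_congr rfl fun x _ => ?_
  set y : ℕ → ι := fun s => x (Fin.ofNat (k + 1) s) with hy
  have hpath : ∀ a, (∀ s ≤ k, Y s a = y s) → (fun s : Fin (k + 1) => Y s a) = x := by
    intro a ha
    ext s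
    simpa [hy] using ha s (Nat.le_of_lt_succ s.2)
  by_cases hx : p x ∧ y k = l
  -- `y` wraps around modulo `k + 1`, so its value at `k + 1` is meaningless and is replaced by the
  -- next state `l'`.
  · let z : ℕ → ι := Function.update y (k + 1) l'
    have hz : ∀ s ≤ k, z s = y s := fun s hs => Function.update_of_ne (by omega) _ _
    have hz' : z (k + 1) = l' := Function.update_self _ _ _
    have h1 : {a | (p (fun s => Y s a) ∧ Y k a = l) ∧ Y (k + 1) a = l'} ∩
        {a | ∀ s ≤ k, Y s a = y s} = {a | ∀ s ≤ k + 1, Y s a = z s} := by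
      ext a
      simp only [Set.mem_inter_iff, Set.mem_ofPred_eq]
      constructor
      · rintro ⟨⟨-, h'⟩, h⟩ s hs
        rcases Nat.le_succ_iff.1 hs with hs | rfl
        · rw [hz s hs, h s hs]
        · rw [h', hz']
      · intro h
        have hk : ∀ s ≤ k, Y s a = y s := fun s hs => by rw [h s (by omega), hz s hs]
        refine ⟨⟨⟨?_, ?_⟩, ?_⟩, hk⟩
        · rw [hpath a hk]
          exact hx.1
        · rw [hk k le_rfl, hx.2]
        · rw [h _ le_rfl, hz']
    have h2 : {a | p (fun s => Y s a) ∧ Y k a = l} ∩ {a | ∀ s ≤ k, Y s a = y s} =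
        {a | ∀ s ≤ k, Y s a = y s} := by
      refine Set.inter_eq_right.2 fun a ha => ⟨?_, (ha k le_rfl).trans hx.2⟩
      rw [hpath a ha]
      exact hx.1
    rw [h1, h2, H.measure_path, H.measure_path, Finset.prod_range_succ, hz 0 (Nat.zero_le _),
      hz', hz k le_rfl, hx.2]
    have hprod : ∏ s ∈ Finset.range k, ENNReal.ofReal (P (z s) (z (s + 1))) =
        ∏ s ∈ Finset.range k, ENNReal.ofReal (P (y s) (y (s + 1))) := by
      refine Finset.prod_congr rfl fun s hs => ?_
      have := Finset.mem_range.1 hs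
      rw [hz s this.le, hz (s + 1) this]
    rw [hprod, mul_assoc]
  · have h2 : {a | p (fun s => Y s a) ∧ Y k a = l} ∩ {a | ∀ s ≤ k, Y s a = y s} = ∅ := by
      refine Set.eq_empty_of_forall_notMem fun a ha => hx ⟨?_, ?_⟩
      · rw [← hpath a ha.2]
        exact ha.1.1
      · exact (ha.2 k le_rfl).symm.trans ha.1.2
    have h1 : {a | (p (fun s => Y s a) ∧ Y k a = l) ∧ Y (k + 1) a = l'} ∩
        {a | ∀ s ≤ k, Y s a = y s} = ∅ :=
      Set.eq_empty_of_subset_empty (h2 ▸ Set.inter_subset_inter_left _ fun _ ha => ha.1)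
    rw [h1, h2, measure_empty, zero_mul]

lemma measurableSet_pair (H : IsMarkovHolding μ P c Y ξ) (j k : ℕ) (i l : ι) :
    MeasurableSet {a | Y j a = i ∧ Y k a = l} :=
  (H.measurable_state j (measurableSet_singleton i)).inter
    (H.measurable_state k (measurableSet_singleton l))

variable [IsFiniteMeasure μ]

/-- The rectangle formula `measure_pair` determines the joint law, which makes Fubini available for
products of functions of the two times. The mass of the conditioning event is absorbed into the
first factor. -/
lemma map_pair (H : IsMarkovHolding μ P c Y ξ) {j k : ℕ} (hjk : j < k) (i l : ι) :
    (μ.restrict {a | Y j a = i ∧ Y k a = l}).map (fun a => (ξ j a, ξ k a)) =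
      (μ {a | Y j a = i ∧ Y k a = l} • expMeasure (c i)).prod (expMeasure (c l)) := by
  have := isProbabilityMeasure_expMeasure (H.rate_pos i)
  have := isProbabilityMeasure_expMeasure (H.rate_pos l)
  have : IsFiniteMeasure (μ {a | Y j a = i ∧ Y k a = l} • expMeasure (c i)) :=
    Measure.smul_finite _ (measure_ne_top _ _)
  have hm : Measurable fun a => (ξ j a, ξ k a) :=
    (H.measurable_time j).prodMk (H.measurable_time k)
  refine (Measure.prod_eq fun U V hU hV => ?_).symm
  rw [Measure.map_apply hm (hU.prod hV), Measure.restrict_apply (hm (hU.prod hV)),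
    Set.inter_comm, Measure.smul_apply, smul_eq_mul]
  exact H.measure_pair hjk i l hU hV

lemma integrableOn_pair (H : IsMarkovHolding μ P c Y ξ) {j k : ℕ} (hjk : j < k) (i l : ι)
    {f g : ℝ → ℝ} (hf : Integrable f (expMeasure (c i))) (hg : Integrable g (expMeasure (c l))) :
    IntegrableOn (fun a => f (ξ j a) * g (ξ k a)) {a | Y j a = i ∧ Y k a = l} μ := by
  have := isProbabilityMeasure_expMeasure (H.rate_pos i)
  have := isProbabilityMeasure_expMeasure (H.rate_pos l)
  have : IsFiniteMeasure (μ {a | Y j a = i ∧ Y k a = l} • expMeasure (c i)) :=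
    Measure.smul_finite _ (measure_ne_top _ _)
  have hm : Measurable fun a => (ξ j a, ξ k a) :=
    (H.measurable_time j).prodMk (H.measurable_time k)
  have hfg := (hf.smul_measure (measure_ne_top μ {a | Y j a = i ∧ Y k a = l})).mul_prod hg
  rw [← H.map_pair hjk] at hfg
  exact hfg.comp_measurable hm

lemma setIntegral_pair (H : IsMarkovHolding μ P c Y ξ) {j k : ℕ} (hjk : j < k) (i l : ι)
    {f g : ℝ → ℝ} (hf : Integrable f (expMeasure (c i))) (hg : Integrable g (expMeasure (c l))) :
    ∫ a in {a | Y j a = i ∧ Y k a = l}, f (ξ j a) * g (ξ k a) ∂μ =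
      μ.real {a | Y j a = i ∧ Y k a = l} * (∫ x, f x ∂expMeasure (c i)) *
        ∫ x, g x ∂expMeasure (c l) := by
  have := isProbabilityMeasure_expMeasure (H.rate_pos i)
  have := isProbabilityMeasure_expMeasure (H.rate_pos l)
  have : IsFiniteMeasure (μ {a | Y j a = i ∧ Y k a = l} • expMeasure (c i)) :=
    Measure.smul_finite _ (measure_ne_top _ _)
  have hm : Measurable fun a => (ξ j a, ξ k a) :=
    (H.measurable_time j).prodMk (H.measurable_time k)
  have hfg := (hf.smul_measure (measure_ne_top μ {a | Y j a = i ∧ Y k a = l})).mul_prod hg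
  have h := integral_map (μ := μ.restrict {a | Y j a = i ∧ Y k a = l}) hm.aemeasurable
    (f := fun z : ℝ × ℝ => f z.1 * g z.2) (by rw [H.map_pair hjk]; exact hfg.aestronglyMeasurable)
  rw [← h, H.map_pair hjk, integral_prod_mul, integral_smul_measure]
  rfl

/-- The centred holding times, weighted by a function of the state. -/
lemma ae_tendsto_average_centred (H : IsMarkovHolding μ P c Y ξ) (w : ι → ℝ) :
    ∀ᵐ a ∂μ, Tendsto (fun n : ℕ =>
      (∑ k ∈ Finset.range n, w (Y k a) * (ξ k a - (c (Y k a))⁻¹)) / n) atTop (𝓝 0) := by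
  have hF : ∀ j k, Measurable fun a => (Y j a, Y k a) := fun j k =>
    (H.measurable_state j).prodMk (H.measurable_state k)
  have hfib : ∀ j k (x : ι × ι), (fun a => (Y j a, Y k a)) ⁻¹' {x} =
      {a | Y j a = x.1 ∧ Y k a = x.2} := fun j k x => by
    ext a
    simp [Prod.ext_iff]
  have hms : ∀ j k (x : ι × ι), MeasurableSet {a | Y j a = x.1 ∧ Y k a = x.2} := fun j k x =>
    H.measurableSet_pair j k x.1 x.2
  have hmeas : ∀ k, Measurable fun a => w (Y k a) * (ξ k a - (c (Y k a))⁻¹) := fun k =>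
    ((measurable_of_finite w).comp (H.measurable_state k)).mul ((H.measurable_time k).sub
      ((measurable_of_finite fun i => (c i)⁻¹).comp (H.measurable_state k)))
  -- The constant function 1 of the time at `k + 1` turns a one-time moment into an instance of the
  -- two-time formulas.
  have hsq_eq : ∀ k (x : ι × ι), Set.EqOn
      (fun a => (w x.1 * (ξ k a - (c x.1)⁻¹)) ^ 2 * (fun _ : ℝ => (1 : ℝ)) (ξ (k + 1) a))
      (fun a => (w (Y k a) * (ξ k a - (c (Y k a))⁻¹)) ^ 2)
      {a | Y k a = x.1 ∧ Y (k + 1) a = x.2} := by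
    rintro k x a ⟨h1, -⟩
    simp [h1]
  have hconst : ∀ i, Integrable (fun _ : ℝ => (1 : ℝ)) (expMeasure (c i)) := fun i =>
    have := isProbabilityMeasure_expMeasure (H.rate_pos i)
    integrable_const _
  have hsq_int : ∀ k (x : ι × ι),
      IntegrableOn (fun a => (w (Y k a) * (ξ k a - (c (Y k a))⁻¹)) ^ 2)
        ((fun a => (Y k a, Y (k + 1) a)) ⁻¹' {x}) μ := by
    intro k x
    rw [hfib]
    exact (H.integrableOn_pair k.lt_succ_self x.1 x.2
      (integrable_centred_sq_expMeasure (H.rate_pos x.1) (w x.1))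
      (hconst x.2)).congr_fun (hsq_eq k x) (hms _ _ x)
  refine ae_tendsto_average_of_orthogonal
    (D := fun k a => w (Y k a) * (ξ k a - (c (Y k a))⁻¹))
    (C := ∑ x : ι × ι, μ.real Set.univ *
      ∫ z, (w x.1 * (z - (c x.1)⁻¹)) ^ 2 ∂expMeasure (c x.1)) ?_ ?_ ?_
  · intro k
    exact (memLp_two_iff_integrable_sq (hmeas k).aestronglyMeasurable).2
      (integrable_of_fiber _ (hsq_int k))
  · intro j k hjk
    -- Once both states are fixed the weights and rates are constants, and the integral factors into
    -- means of centred exponentials.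
    have heq : ∀ x : ι × ι, Set.EqOn
        (fun a => (w x.1 * (ξ j a - (c x.1)⁻¹)) * (w x.2 * (ξ k a - (c x.2)⁻¹)))
        (fun a => w (Y j a) * (ξ j a - (c (Y j a))⁻¹) * (w (Y k a) * (ξ k a - (c (Y k a))⁻¹)))
        {a | Y j a = x.1 ∧ Y k a = x.2} := by
      rintro x a ⟨h1, h2⟩
      simp [h1, h2]
    rw [integral_eq_sum_fiber (hF j k)]
    · refine Finset.sum_eq_zero fun x _ => ?_
      rw [hfib, ← setIntegral_congr_fun (hms _ _ x) (heq x),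
        H.setIntegral_pair hjk x.1 x.2 (integrable_centred_expMeasure (H.rate_pos _) _)
          (integrable_centred_expMeasure (H.rate_pos _) _),
        integral_centred_expMeasure (H.rate_pos _), mul_zero, zero_mul]
    · intro x
      rw [hfib]
      exact (H.integrableOn_pair hjk x.1 x.2 (integrable_centred_expMeasure (H.rate_pos _) _)
        (integrable_centred_expMeasure (H.rate_pos _) _)).congr_fun (heq x) (hms _ _ x)
  · intro k
    rw [integral_eq_sum_fiber (hF k (k + 1)) (hsq_int k)]
    refine Finset.sum_le_sum fun x _ => ?_
    have := isProbabilityMeasure_expMeasure (H.rate_pos x.2)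
    rw [hfib, ← setIntegral_congr_fun (hms _ _ x) (hsq_eq k x),
      H.setIntegral_pair k.lt_succ_self x.1 x.2
        (integrable_centred_sq_expMeasure (H.rate_pos _) _) (hconst x.2)]
    simp only [integral_const, probReal_univ, smul_eq_mul, mul_one]
    exact mul_le_mul_of_nonneg_right (measureReal_mono (Set.subset_univ _))
      (integral_nonneg fun _ => sq_nonneg _)

lemma integrable_state (H : IsMarkovHolding μ P c Y ξ) (g : ι → ℝ) (k : ℕ) :
    Integrable (fun a => g (Y k a)) μ :=
  Integrable.comp_measurable (Integrable.of_finite (μ := μ.map (Y k))) (H.measurable_state k)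

/-- The increments of the chain are centred given its past. -/
lemma setIntegral_increment (H : IsMarkovHolding μ P c Y ξ) (g : ι → ℝ) (k : ℕ)
    (p : (Fin (k + 1) → ι) → Prop) (l : ι) :
    ∫ a in {a | p (fun s => Y s a) ∧ Y k a = l}, (g (Y (k + 1) a) - (P *ᵥ g) (Y k a)) ∂μ = 0 := by
  set E := {a | p (fun s => Y s a) ∧ Y k a = l} with hE
  have hEm : MeasurableSet E := by
    have h1 : MeasurableSet {x : Fin (k + 1) → ι | p x} := (Set.toFinite _).measurableSet
    exact ((measurable_pi_lambda _ fun s : Fin (k + 1) => H.measurable_state s) h1).inter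
      (H.measurable_state k (measurableSet_singleton l))
  have h1 : ∫ a in E, (P *ᵥ g) (Y k a) ∂μ = μ.real E * (P *ᵥ g) l := by
    rw [setIntegral_congr_fun (g := fun _ => (P *ᵥ g) l) hEm
      (fun a ha => congrArg (P *ᵥ g) ha.2), setIntegral_const, smul_eq_mul]
  rw [integral_sub (H.integrable_state g (k + 1)).integrableOn
    (H.integrable_state (P *ᵥ g) k).integrableOn, h1,
    integral_eq_sum_fiber (H.measurable_state (k + 1))
      fun x => (H.integrable_state g (k + 1)).integrableOn.integrableOn, Matrix.mulVec, dotProduct,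
    Finset.mul_sum, sub_eq_zero]
  refine Finset.sum_congr rfl fun l' _ => ?_
  have hm := H.measurable_state (k + 1) (measurableSet_singleton l')
  rw [Measure.restrict_restrict hm,
    setIntegral_congr_fun (g := fun _ => g l') (hm.inter hEm) (fun a ha => congrArg g ha.1),
    setIntegral_const, smul_eq_mul, Set.inter_comm]
  have hstep : μ (E ∩ Y (k + 1) ⁻¹' {l'}) = μ E * ENNReal.ofReal (P l l') :=
    H.measure_step k p l l'
  rw [measureReal_def, hstep, ENNReal.toReal_mul, ENNReal.toReal_ofReal (H.nonneg l l'),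
    measureReal_def, mul_assoc]

lemma ae_tendsto_average_increment (H : IsMarkovHolding μ P c Y ξ) (g : ι → ℝ) :
    ∀ᵐ a ∂μ, Tendsto (fun n : ℕ =>
      (∑ k ∈ Finset.range n, (g (Y (k + 1) a) - (P *ᵥ g) (Y k a))) / n) atTop (𝓝 0) := by
  let K : ℝ := ∑ i, |g i| + ∑ i, |(P *ᵥ g) i|
  have hK : ∀ k a, |g (Y (k + 1) a) - (P *ᵥ g) (Y k a)| ≤ K := fun k a =>
    (abs_sub _ _).trans (add_le_add
      (Finset.single_le_sum (f := fun i => |g i|) (fun _ _ => abs_nonneg _) (Finset.mem_univ _))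
      (Finset.single_le_sum (f := fun i => |(P *ᵥ g) i|) (fun _ _ => abs_nonneg _)
        (Finset.mem_univ _)))
  have hmeas : ∀ k, Measurable fun a => g (Y (k + 1) a) - (P *ᵥ g) (Y k a) := fun k =>
    ((measurable_of_finite g).comp (H.measurable_state _)).sub
      ((measurable_of_finite (P *ᵥ g)).comp (H.measurable_state k))
  have hLp : ∀ k, MemLp (fun a => g (Y (k + 1) a) - (P *ᵥ g) (Y k a)) 2 μ := fun k =>
    MemLp.of_bound (hmeas k).aestronglyMeasurable K (ae_of_all _ (hK k))
  refine ae_tendsto_average_of_orthogonal (C := μ.real Set.univ * K ^ 2) hLp ?_ ?_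
  · intro j k hjk
    have hF : Measurable fun a => ((Y j a, Y (j + 1) a), Y k a) :=
      ((H.measurable_state j).prodMk (H.measurable_state _)).prodMk (H.measurable_state k)
    have hint : Integrable (fun a => (g (Y (j + 1) a) - (P *ᵥ g) (Y j a)) *
        (g (Y (k + 1) a) - (P *ᵥ g) (Y k a))) μ := (hLp j).integrable_mul (hLp k)
    rw [integral_eq_sum_fiber hF fun x => hint.integrableOn]
    refine Finset.sum_eq_zero fun x _ => ?_
    obtain ⟨⟨i, i'⟩, l⟩ := x
    -- Since `j + 1 ≤ k`, the increment at `j` is determined by the past up to time `k`; it is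
    -- constant on each fibre, where the increment at `k` integrates to zero.
    let p : (Fin (k + 1) → ι) → Prop := fun y =>
      y ⟨j, by omega⟩ = i ∧ y ⟨j + 1, by omega⟩ = i'
    have hfib : (fun a => ((Y j a, Y (j + 1) a), Y k a)) ⁻¹' {((i, i'), l)} =
        {a | p (fun s => Y s a) ∧ Y k a = l} := by
      ext a
      simp [p]
    rw [setIntegral_congr_fun
      (g := fun a => (g i' - (P *ᵥ g) i) * (g (Y (k + 1) a) - (P *ᵥ g) (Y k a)))
      (hF (measurableSet_singleton _)), hfib, integral_const_mul, H.setIntegral_increment,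
      mul_zero]
    intro a ha
    simp only [Set.mem_preimage, Set.mem_singleton_iff, Prod.mk.injEq] at ha
    simp only [ha.1.1, ha.1.2]
  · intro k
    have : ∫ a, (g (Y (k + 1) a) - (P *ᵥ g) (Y k a)) ^ 2 ∂μ ≤ ∫ _, K ^ 2 ∂μ :=
      integral_mono (hLp k).integrable_sq (integrable_const _) fun a =>
        sq_le_sq' (abs_le.1 (hK k a)).1 (abs_le.1 (hK k a)).2
    rwa [integral_const, smul_eq_mul] at this

/-- The ergodic theorem for the weighted holding times. -/
theorem ae_tendsto_average [DecidableEq ι] [Nonempty ι] (H : IsMarkovHolding μ P c Y ξ)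
    (hirr : ∀ i j, Relation.ReflTransGen (fun a b => 0 < P a b) i j)
    {π : ι → ℝ} (hπ : IsStationary P π) (w : ι → ℝ) :
    ∀ᵐ a ∂μ, Tendsto (fun n : ℕ => (∑ k ∈ Finset.range n, ξ k a * w (Y k a)) / n) atTop
      (𝓝 (π ⬝ᵥ fun i => w i / c i)) := by
  obtain ⟨g, hg⟩ := exists_poisson H.nonneg H.row_sum hirr hπ fun i => w i / c i
  set b := π ⬝ᵥ fun i => w i / c i
  filter_upwards [H.ae_tendsto_average_centred w, H.ae_tendsto_average_increment g] with a h1 h2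
  -- This is the telescoped part of the decomposition: a bounded quantity divided by `n`.
  have h3 : Tendsto (fun n : ℕ => (g (Y 0 a) - g (Y n a)) / n) atTop (𝓝 0) := by
    have hbdd : ∀ n, |g (Y 0 a) - g (Y n a)| ≤ 2 * ∑ i, |g i| := fun n => by
      have hs : ∀ i, |g i| ≤ ∑ i, |g i| := fun i =>
        Finset.single_le_sum (f := fun i => |g i|) (fun _ _ => abs_nonneg _) (Finset.mem_univ _)
      linarith [abs_sub (g (Y 0 a)) (g (Y n a)), hs (Y 0 a), hs (Y n a)]
    refine squeeze_zero_norm (fun n => ?_)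
      (tendsto_const_div_atTop_nhds_zero_nat (2 * ∑ i, |g i|))
    rw [norm_div, Real.norm_eq_abs, RCLike.norm_natCast]
    gcongr
    exact hbdd n
  have h4 := ((h1.add h2).add h3).add_const b
  simp only [zero_add] at h4
  refine h4.congr' ?_
  filter_upwards [eventually_gt_atTop 0] with n hn
  have hn' : (n : ℝ) ≠ 0 := by exact_mod_cast hn.ne'
  have htel := Finset.sum_range_sub' (fun k => g (Y k a)) n
  have hb : b = (∑ _k ∈ Finset.range n, b) / n := by
    rw [Finset.sum_const, Finset.card_range, nsmul_eq_mul, mul_div_cancel_left₀ _ hn']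
  rw [← htel, ← add_div, ← add_div, ← Finset.sum_add_distrib, ← Finset.sum_add_distrib]
  conv_lhs => rw [hb]
  rw [← add_div, ← Finset.sum_add_distrib]
  congr 1
  refine Finset.sum_congr rfl fun k _ => ?_
  have := hg (Y k a)
  rw [div_eq_mul_inv] at this
  linarith

end IsMarkovHolding

/-! ### The growth rate for a single type -/

section
variable {m : ℕ} {Q : Matrix (Fin m) (Fin m) ℝ} {S : Type*} [MeasurableSpace S] {μ : Measure S}
  {X : ℝ≥0 → S → Fin m}

lemma IsMarkovEnvironment.isMarkovHolding (hX : IsMarkovEnvironment μ Q X)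
    (hQ : IsIrreducibleGenerator Q) (hm : 2 ≤ m) :
    IsMarkovHolding μ (jumpMatrix Q) (rate Q) (fun k a => jumpState (fun t => X t a) k)
      (fun k a => sojourn (fun t => X t a) k) where
  nonneg := hQ.jumpMatrix_nonneg hm
  row_sum := hQ.jumpMatrix_row_sum hm
  rate_pos := hQ.rate_pos hm
  measurable_state := hX.measurable_jumpState
  measurable_time := hX.measurable_sojourn
  law := hX.law

lemma exp_unique_apply (A : Matrix (Fin 1) (Fin 1) ℝ) :
    NormedSpace.exp A 0 0 = Real.exp (A 0 0) := by
  have : A = Matrix.diagonal fun i => A i i := by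
    ext i j
    fin_cases i
    fin_cases j
    simp
  rw [this, Matrix.exp_diagonal]
  simp [Pi.coe_exp, Real.exp_eq_exp_ℝ]

lemma meanProduct_unique (Om : Fin m → Matrix (Fin 1) (Fin 1) ℝ) (x : ℝ≥0 → Fin m) (n : ℕ) :
    meanProduct Om x n 0 0 =
      Real.exp (∑ k ∈ Finset.range n, sojourn x k * lam Om (jumpState x k)) := by
  induction n with
  | zero => simp [meanProduct]
  | succ n ih =>
    simp only [meanProduct, Matrix.mul_apply, Fin.sum_univ_one, Finset.sum_range_succ, Real.exp_add,
      exp_unique_apply, ih, Matrix.smul_apply, smul_eq_mul, lam, maxRealPart_unique]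

lemma isGrowthRate_meanRate [IsFiniteMeasure μ] (hm : 2 ≤ m) (hQ : IsIrreducibleGenerator Q)
    (Om : Fin m → Matrix (Fin 1) (Fin 1) ℝ) (hX : IsMarkovEnvironment μ Q X) :
    IsGrowthRate μ Om X (meanRate Q Om) := by
  intro i j
  fin_cases i
  fin_cases j
  have : Nonempty (Fin m) := ⟨⟨0, by omega⟩⟩
  rw [hQ.meanRate_eq hm]
  filter_upwards [(hX.isMarkovHolding hQ hm).ae_tendsto_average (hQ.jumpMatrix_irreducible hm)
    (hQ.isStationary_piHat hm) (lam Om)] with a ha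
  refine ha.congr fun n => ?_
  have h := meanProduct_unique Om (fun t => X t a) n
  change _ = 1 / (n : ℝ) * Real.log (meanProduct Om (fun t => X t a) n 0 0)
  rw [h, Real.log_exp]
  ring

/-- For a nonzero measure two almost sure limits hold together at some point, where limits are
unique; `NeZero r` supplies a matrix entry to look at. -/
lemma IsGrowthRate.unique {r : ℕ} [NeZero r] [NeZero μ] {Om : Fin m → Matrix (Fin r) (Fin r) ℝ}
    {w w' : ℝ} (h : IsGrowthRate μ Om X w) (h' : IsGrowthRate μ Om X w') : w = w' := by
  obtain ⟨a, ha, ha'⟩ := ((h 0 0).and (h' 0 0)).exists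
  exact tendsto_nhds_unique ha ha'

end

end BranchingEnv

theorem mainTheorem6 {m : ℕ} (hm : 2 ≤ m)
    (Q : Matrix (Fin m) (Fin m) ℝ) (hQ : BranchingEnv.IsIrreducibleGenerator Q)
    {r : ℕ} (hr : r = 1) (Om : Fin m → Matrix (Fin r) (Fin r) ℝ)
    {S : Type*} [MeasurableSpace S] (μ : Measure S) [IsProbabilityMeasure μ]
    (X : ℝ≥0 → S → Fin m) (hX : BranchingEnv.IsMarkovEnvironment μ Q X) :
    ∃ ω : ℝ, (∀ w : ℝ, BranchingEnv.IsGrowthRate μ Om X w ↔ w = ω) ∧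
      BranchingEnv.omegaL Q Om = ω ∧
      BranchingEnv.omegaLTilde Q Om = ω ∧
      (BranchingEnv.IsCyclic Q → BranchingEnv.omegaLStar Q Om = ω) ∧
      BranchingEnv.omegaU Q Om = ω ∧
      ω = BranchingEnv.meanRate Q Om := by
  subst hr
  have hc : ∀ l, BranchingEnv.rate Q l ≠ 0 := fun l => (hQ.rate_pos hm l).ne'
  have h := BranchingEnv.isGrowthRate_meanRate hm hQ Om hX
  exact ⟨BranchingEnv.meanRate Q Om, fun w => ⟨fun hw => hw.unique h, fun hw => hw ▸ h⟩,
    BranchingEnv.omegaL_unique Om hc, BranchingEnv.omegaLTilde_unique Om hc,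
    fun _ => BranchingEnv.omegaLStar_unique Om, BranchingEnv.omegaU_unique Om hm hQ, rfl⟩
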